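/- Let $X=\{X(t),\,t\in\mathbb Z\}$ be a real-valued, (strictly) stationary stochastic process on a probability space $(\Omega,\mathcal A,\mathbb P)$ which is max-infinitely divisible, i.e. for every integer $n\ge 1$ it has the same law as the componentwise maximum of $n$ independent identically distributed processes indexed by $\mathbb Z$. Let $l=\operatorname{ess\,inf} X(0)\in[-\infty,\infty)$ and, for real $a>l$ and $t\in\mathbb Z$, put $$\tau_a(t)=\log\mathbb P[X(0)\le a,\,X(t)\le a]-\log\mathbb P[X(0)\le a]-\log\mathbb P[X(t)\le a].$$ Let $\mu$ be the law of $X$ on $\mathbb R^{\mathbb Z}$ with its product $\sigma$-algebra, and let $S$ be the shift, $(Sx)(t)=x(t+1)$. Then the following conditions are equivalent: 1. $X$ is ergodic, i.e. every measurable set $A\subseteq\mathbb R^{\mathbb Z}$ with $S^{-1}A=A$ has $\mu(A)\in\{0,1\}$. 2. $X$ is weakly mixing, i.e. for all measurable $A,B\subseteq\mathbb R^{\mathbb Z}$, $\lim_{n\to\infty}\frac1n\sum_{t=1}^n\left|\mu(A\cap S^{-t}B)-\mu(A)\mu(B)\right|=0$. 3. For every real $a>l$, $\lim_{n\to\infty}\frac1n\sum_{t=1}^n\tau_a(t)=0$.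 -/

import Mathlib

open MeasureTheory ProbabilityTheory Filter Topology

noncomputable section

namespace MaxID

variable {Ω : Type*} [MeasurableSpace Ω]

/-- The law of the process `X` on the path space `ℤ → ℝ` with the product σ-algebra. -/
def pathLaw (X : ℤ → Ω → ℝ) (P : Measure Ω) : Measure (ℤ → ℝ) :=
  P.map fun ω t => X t ω

/-- The left shift on the path space. -/
def shift (x : ℤ → ℝ) : ℤ → ℝ := fun t => x (t + 1)

/-- `X` is (strictly) stationary: every time translate of the process has the same law. -/
def IsStationary (X : ℤ → Ω → ℝ) (P : Measure Ω) : Prop :=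
  ∀ s : ℤ, pathLaw (fun t => X (t + s)) P = pathLaw X P

/-- `X` is max-infinitely divisible: for every `n ≥ 1` it has the law of the componentwise maximum
of `n` independent processes `y 0, …, y (n - 1)` with a common law `ν`. -/
def IsMaxID (X : ℤ → Ω → ℝ) (P : Measure Ω) : Prop :=
  ∀ n : ℕ, 0 < n → ∃ ν : Measure (ℤ → ℝ), IsProbabilityMeasure ν ∧
    pathLaw X P =
      (Measure.pi fun _ : Fin n => ν).map fun (y : Fin n → ℤ → ℝ) (t : ℤ) => ⨆ i, y i t

/-- `X` is ergodic: the shift is ergodic for the law of `X` on the path space. -/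
def IsErgodic (X : ℤ → Ω → ℝ) (P : Measure Ω) : Prop :=
  Ergodic shift (pathLaw X P)

/-- `X` is weakly mixing: the shift is weakly mixing for the law of `X` on the path space. -/
def IsWeaklyMixing (X : ℤ → Ω → ℝ) (P : Measure Ω) : Prop :=
  MeasurePreserving shift (pathLaw X P) (pathLaw X P) ∧
    ∀ A B : Set (ℤ → ℝ), MeasurableSet A → MeasurableSet B →
      Tendsto
        (fun n : ℕ => (1 / (n : ℝ)) * ∑ t ∈ Finset.Icc 1 n,
          |(pathLaw X P).real (A ∩ shift^[t] ⁻¹' B) -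
            (pathLaw X P).real A * (pathLaw X P).real B|)
        atTop (𝓝 0)

/-- The essential infimum `l ∈ [-∞, ∞)` of `X 0`. -/
def lowerEndpoint (X : ℤ → Ω → ℝ) (P : Measure Ω) : EReal :=
  essInf (fun ω => (X 0 ω : EReal)) P

/-- The dependence coefficient `τ_a(t)`. -/
def tau (X : ℤ → Ω → ℝ) (P : Measure Ω) (a : ℝ) (t : ℤ) : ℝ :=
  Real.log (P.real {ω | X 0 ω ≤ a ∧ X t ω ≤ a}) - Real.log (P.real {ω | X 0 ω ≤ a})
    - Real.log (P.real {ω | X t ω ≤ a})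

end MaxID

end

/-! Max-infinite divisibility supplies laws `ν n` with `μ A = (ν n A) ^ (n + 1)` for every
measurable set `A` of paths that is an ideal for suprema. Since `(n + 1) * (1 - ν n A)` tends to
`-log (μ A)`, inclusion-exclusion shows that `logDep μ A B` is the limit of `(n + 1) * ν n (Aᶜ ∩
Bᶜ)` (`HasIdealRoots.exists_tendsto_logDep`). Hence `logDep` is nonnegative and subadditive over
finite covers of `Aᶜ ∩ Bᶜ`, and it is comparable with the covariance `μ (A ∩ B) - μ A * μ B`.

3 → 2: by subadditivity the covariance of two finite-dimensional orthants at lag `t` is at most a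
finite sum of translates of `tau` at one common level. Weak mixing then passes from this π-system to
all measurable sets, one argument at a time. 1 → 3: the mean ergodic theorem makes the averaged
covariance of two half-spaces vanish, and it dominates `tau`. 2 → 1: an invariant set satisfies `μ A
= μ A ^ 2`. -/

noncomputable section

namespace MaxID

/-! ### Cesàro means -/

/-- The Cesàro mean of `u 1, …, u n`. -/
def cesaroMean (u : ℕ → ℝ) (n : ℕ) : ℝ :=
  (1 / (n : ℝ)) * ∑ t ∈ Finset.Icc 1 n, u t

theorem cesaroMean_mono {u v : ℕ → ℝ} (h : ∀ t, u t ≤ v t) (n : ℕ) :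
    cesaroMean u n ≤ cesaroMean v n :=
  mul_le_mul_of_nonneg_left (Finset.sum_le_sum fun t _ => h t) (by positivity)

theorem cesaroMean_nonneg {u : ℕ → ℝ} (h : ∀ t, 0 ≤ u t) (n : ℕ) : 0 ≤ cesaroMean u n :=
  mul_nonneg (by positivity) (Finset.sum_nonneg fun t _ => h t)

theorem cesaroMean_const {c : ℝ} {n : ℕ} (hn : n ≠ 0) : cesaroMean (fun _ => c) n = c := by
  have : (n : ℝ) ≠ 0 := by exact_mod_cast hn
  simp [cesaroMean]
  field_simp

theorem cesaroMean_const_le {c : ℝ} (hc : 0 ≤ c) (n : ℕ) : cesaroMean (fun _ => c) n ≤ c := by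
  rcases eq_or_ne n 0 with rfl | hn
  · simpa [cesaroMean]
  · exact (cesaroMean_const hn).le

theorem tendsto_cesaroMean_const (c : ℝ) : Tendsto (cesaroMean fun _ => c) atTop (𝓝 c) := by
  refine tendsto_const_nhds.congr' ?_
  filter_upwards [eventually_ne_atTop 0] with n hn using (cesaroMean_const hn).symm

theorem cesaroMean_sub (u v : ℕ → ℝ) (n : ℕ) :
    cesaroMean (fun t => u t - v t) n = cesaroMean u n - cesaroMean v n := by
  simp [cesaroMean, Finset.sum_sub_distrib, mul_sub]

theorem cesaroMean_const_mul (c : ℝ) (u : ℕ → ℝ) (n : ℕ) :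
    cesaroMean (fun t => c * u t) n = c * cesaroMean u n := by
  simp only [cesaroMean, ← Finset.mul_sum]
  ring

theorem cesaroMean_finset_sum {ι : Type*} (s : Finset ι) (u : ι → ℕ → ℝ) (n : ℕ) :
    cesaroMean (fun t => ∑ i ∈ s, u i t) n = ∑ i ∈ s, cesaroMean (u i) n := by
  simp only [cesaroMean, ← Finset.mul_sum]
  rw [Finset.sum_comm]

theorem cesaroMean_eq_sum_range (u : ℕ → ℝ) (n : ℕ) :
    cesaroMean u n = (n : ℝ)⁻¹ * ∑ t ∈ Finset.range n, u (t + 1) := by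
  rw [cesaroMean, Finset.range_eq_Ico, Finset.sum_Ico_add' u 0 n 1, one_div]
  congr 2

theorem tendsto_cesaroMean_zero_of_le {u v : ℕ → ℝ} (h0 : ∀ t, 0 ≤ u t) (h : ∀ t, u t ≤ v t)
    (hv : Tendsto (cesaroMean v) atTop (𝓝 0)) : Tendsto (cesaroMean u) atTop (𝓝 0) :=
  squeeze_zero (cesaroMean_nonneg h0) (cesaroMean_mono h) hv

/-! ### Mean ergodic theorem for sets -/

section Ergodic

variable {α : Type*} [MeasurableSpace α] {μ : Measure α} [IsProbabilityMeasure μ]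

/-- For an ergodic map, the Cesàro means of `μ (A ∩ f⁻ᵗ B)` converge to `μ A * μ B`. -/
theorem tendsto_cesaroMean_measureReal_inter {f : α → α} (h : Ergodic f μ) {A B : Set α}
    (hA : MeasurableSet A) (hB : MeasurableSet B) :
    Tendsto (cesaroMean fun t => μ.real (A ∩ f^[t] ⁻¹' B)) atTop
      (𝓝 (μ.real A * μ.real B)) := by
  have hf := h.toMeasurePreserving
  let U : Lp ℝ 2 μ →L[ℝ] Lp ℝ 2 μ :=
    (Lp.compMeasurePreservingₗᵢ ℝ f hf).toContinuousLinearMap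
  have hU : ‖U‖ ≤ 1 := LinearIsometry.norm_toContinuousLinearMap_le _
  -- Birkhoff sums start at `t = 0` and Cesàro sums at `t = 1`; the preimage under `f` absorbs the
  -- difference.
  let x : Lp ℝ 2 μ := indicatorConstLp 2 (hf.measurable hB) (measure_ne_top _ _) 1
  have hlim := U.tendsto_birkhoffAverage_orthogonalProjection hU x
  set g := (U.eqLocus (1 : Lp ℝ 2 μ →L[ℝ] Lp ℝ 2 μ)).orthogonalProjectionOnto x
  have hiter (t : ℕ) : U^[t] x = indicatorConstLp 2 ((hf.iterate (t + 1)).measurable hB)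
      (measure_ne_top _ _) 1 := by
    change (Lp.compMeasurePreserving f hf)^[t] x = _
    rw [Lp.compMeasurePreserving_iterate, Lp.indicatorConstLp_compMeasurePreserving]
    simp only [← Set.preimage_comp, ← Function.iterate_succ']
  have key {C : Set α} (hC : MeasurableSet C) :
      Tendsto (cesaroMean fun t => μ.real (C ∩ f^[t] ⁻¹' B)) atTop
        (𝓝 (∫ y in C, (g : Lp ℝ 2 μ) y ∂μ)) := by
    rw [← L2.inner_indicatorConstLp_one (𝕜 := ℝ) hC (measure_ne_top _ _)]
    refine (tendsto_const_nhds.inner hlim).congr fun n => ?_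
    rw [cesaroMean_eq_sum_range, birkhoffAverage, birkhoffSum, inner_smul_right, inner_sum]
    congr 1
    refine Finset.sum_congr rfl fun t _ => ?_
    rw [id, hiter, L2.real_inner_indicatorConstLp_one_indicatorConstLp_one]
  -- The projection is a fixed vector of `U`, so ergodicity makes it constant.
  obtain ⟨c, hc⟩ : ∃ c, (g : Lp ℝ 2 μ) =ᵐ[μ] Function.const α c := by
    refine h.ae_eq_const_of_ae_eq_comp_ae (Lp.aestronglyMeasurable _) ?_
    have hg : Lp.compMeasurePreserving f hf (g : Lp ℝ 2 μ) = g := g.2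
    have := Lp.coeFn_compMeasurePreserving (g : Lp ℝ 2 μ) hf
    rw [hg] at this
    exact this.symm
  have hint (C : Set α) : ∫ y in C, (g : Lp ℝ 2 μ) y ∂μ = μ.real C * c := by
    rw [integral_congr_ae (ae_restrict_of_ae hc)]
    simp
  have hcB : c = μ.real B := by
    have h1 := key MeasurableSet.univ
    simp only [hint, Set.univ_inter, probReal_univ, one_mul] at h1
    refine tendsto_nhds_unique h1 ?_
    simp only [(hf.iterate _).measureReal_preimage hB.nullMeasurableSet]
    exact tendsto_cesaroMean_const _
  have := key hA
  rwa [hint, hcB] at this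

end Ergodic

/-! ### From a π-system to the σ-algebra -/

section Extension

variable {α : Type*} [m : MeasurableSpace α] {μ : Measure α} [IsFiniteMeasure μ]

/-- Convergence to zero in Cesàro mean extends from a π-system to the σ-algebra it generates, for a
sequence of signed measures of total mass zero that are dominated by a finite measure. -/
theorem tendsto_cesaroMean_abs_of_isPiSystem {C : Set (Set α)}
    (hgen : m = MeasurableSpace.generateFrom C) (hpi : IsPiSystem C) (d : ℕ → SignedMeasure α)
    (huniv : ∀ t, d t Set.univ = 0) (hbound : ∀ t B, MeasurableSet B → |d t B| ≤ μ.real B)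
    (hC : ∀ B ∈ C, Tendsto (cesaroMean fun t => |d t B|) atTop (𝓝 0)) {B : Set α}
    (hB : MeasurableSet B) : Tendsto (cesaroMean fun t => |d t B|) atTop (𝓝 0) := by
  induction B, hB using MeasurableSpace.induction_on_inter hgen hpi with
  | empty => simpa using tendsto_cesaroMean_const 0
  | basic B hB => exact hC B hB
  | compl B hB ih =>
    refine ih.congr fun n => ?_
    congr 1
    ext t
    have := VectorMeasure.of_add_of_sdiff hB MeasurableSet.univ (Set.subset_univ B) (v := d t)
    rw [huniv, ← Set.compl_eq_univ_sdiff] at this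
    rw [← abs_neg, eq_comm]
    congr 1
    linarith
  | iUnion B hdisj hB ih =>
    have hs : Summable fun i => μ.real (B i) :=
      ENNReal.summable_toReal ((measure_iUnion hdisj hB).symm ▸ measure_ne_top _ _)
    have hst (t : ℕ) : Summable fun i => |d t (B i)| :=
      hs.of_nonneg_of_le (fun _ => abs_nonneg _) fun i => hbound t _ (hB i)
    -- Dominated convergence over `i`, with the summable bound `μ.real (B i)`, interchanges the
    -- limit with the countable sum.
    have hlim : Tendsto (fun n => ∑' i, cesaroMean (fun t => |d t (B i)|) n) atTop (𝓝 0) := by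
      have := tendsto_tsum_of_dominated_convergence hs ih (Eventually.of_forall fun n i => ?_)
      · simpa using this
      · rw [Real.norm_of_nonneg (cesaroMean_nonneg (fun _ => abs_nonneg _) n)]
        exact (cesaroMean_mono (fun t => hbound t _ (hB i)) n).trans
          (cesaroMean_const_le measureReal_nonneg n)
    refine squeeze_zero (cesaroMean_nonneg fun _ => abs_nonneg _) (fun n => ?_) hlim
    have : ∑' i, cesaroMean (fun t => |d t (B i)|) n
        = cesaroMean (fun t => ∑' i, |d t (B i)|) n := by
      simp only [cesaroMean]
      rw [tsum_mul_left, Summable.tsum_finsetSum fun t _ => hst t]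
    rw [this]
    refine cesaroMean_mono (fun t => ?_) n
    rw [(d t).of_disjoint_iUnion hB hdisj]
    exact norm_tsum_le_tsum_norm (f := fun i => d t (B i)) (hst t)

/-- To check weak mixing of a measure preserving map it suffices to consider a generating
π-system. -/
theorem tendsto_cesaroMean_abs_measureReal_inter_of_isPiSystem {f : α → α}
    [IsProbabilityMeasure μ] (hf : MeasurePreserving f μ μ) {C : Set (Set α)}
    (hgen : m = MeasurableSpace.generateFrom C) (hpi : IsPiSystem C)
    (hC : ∀ A ∈ C, ∀ B ∈ C,
      Tendsto (cesaroMean fun t => |μ.real (A ∩ f^[t] ⁻¹' B) - μ.real A * μ.real B|) atTop (𝓝 0))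
    {A B : Set α} (hA : MeasurableSet A) (hB : MeasurableSet B) :
    Tendsto (cesaroMean fun t => |μ.real (A ∩ f^[t] ⁻¹' B) - μ.real A * μ.real B|) atTop
      (𝓝 0) := by
  have habs {x y z : ℝ} (hx : 0 ≤ x) (hxz : x ≤ z) (hy : 0 ≤ y) (hyz : y ≤ z) :
      |x - y| ≤ z := abs_sub_le_of_nonneg_of_le hx hxz hy hyz
  have hmeas {D : Set α} (hD : D ∈ C) : MeasurableSet D := by
    rw [hgen]
    exact MeasurableSpace.measurableSet_generateFrom hD
  have hpre (t : ℕ) {D : Set α} (hD : MeasurableSet D) : MeasurableSet (f^[t] ⁻¹' D) :=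
    (hf.iterate t).measurable hD
  have hpreμ (t : ℕ) {D : Set α} (hD : MeasurableSet D) : μ.real (f^[t] ⁻¹' D) = μ.real D :=
    (hf.iterate t).measureReal_preimage hD.nullMeasurableSet
  have hle {A : Set α} {x : ℝ} (hx : 0 ≤ x) : μ.real A * x ≤ x :=
    mul_le_of_le_one_left hx measureReal_le_one
  have step {A : Set α} (hA : MeasurableSet A) (hAC : A ∈ C) {B : Set α} (hB : MeasurableSet B) :
      Tendsto (cesaroMean fun t => |μ.real (A ∩ f^[t] ⁻¹' B) - μ.real A * μ.real B|) atTop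
        (𝓝 0) := by
    let d (t : ℕ) : SignedMeasure α :=
      ((μ.restrict A).map f^[t]).toSignedMeasure - μ.real A • μ.toSignedMeasure
    have hd (t : ℕ) {D : Set α} (hD : MeasurableSet D) :
        d t D = μ.real (A ∩ f^[t] ⁻¹' D) - μ.real A * μ.real D := by
      simp only [d, sub_apply, smul_apply,
        Measure.toSignedMeasure_apply_measurable hD, smul_eq_mul]
      rw [map_measureReal_apply (hf.iterate t).measurable hD, measureReal_restrict_apply (hpre t hD),
        Set.inter_comm]
    have := tendsto_cesaroMean_abs_of_isPiSystem (μ := μ) hgen hpi d (fun t => ?_)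
      (fun t D hD => ?_) (fun D hD => ?_) hB
    · simpa only [hd _ hB] using this
    · simp [hd t MeasurableSet.univ]
    · rw [hd t hD]
      exact habs measureReal_nonneg
        ((measureReal_mono Set.inter_subset_right).trans (hpreμ t hD).le) (by positivity)
        (hle measureReal_nonneg)
    · simpa only [hd _ (hmeas hD)] using hC A hAC D hD
  -- The second argument is now arbitrary and held fixed, while the first leaves the π-system.
  let d (t : ℕ) : SignedMeasure α :=
    (μ.restrict (f^[t] ⁻¹' B)).toSignedMeasure - μ.real B • μ.toSignedMeasure
  have hd (t : ℕ) {D : Set α} (hD : MeasurableSet D) :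
      d t D = μ.real (D ∩ f^[t] ⁻¹' B) - μ.real D * μ.real B := by
    simp only [d, sub_apply, smul_apply,
      Measure.toSignedMeasure_apply_measurable hD, smul_eq_mul]
    rw [measureReal_restrict_apply hD, mul_comm]
  have := tendsto_cesaroMean_abs_of_isPiSystem (μ := μ) hgen hpi d (fun t => ?_)
    (fun t D hD => ?_) (fun D hD => ?_) hA
  · simpa only [hd _ hA] using this
  · simp [hd t MeasurableSet.univ, hpreμ t hB]
  · rw [hd t hD, mul_comm]
    exact habs measureReal_nonneg (measureReal_mono Set.inter_subset_left) (by positivity)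
      (hle measureReal_nonneg)
  · simpa only [hd _ (hmeas hD)] using step (hmeas hD) hD hB

end Extension

/-! ### Logarithmic dependence of events -/

section LogDep

variable {E : Type*} [MeasurableSpace E]

/-- The logarithmic dependence `log (μ (A ∩ B) / (μ A * μ B))` of two events. -/
def logDep (μ : Measure E) (A B : Set E) : ℝ :=
  Real.log (μ.real (A ∩ B)) - Real.log (μ.real A) - Real.log (μ.real B)

theorem exp_logDep {μ : Measure E} {A B : Set E} (hA0 : 0 < μ.real A) (hB0 : 0 < μ.real B)
    (hAB0 : 0 < μ.real (A ∩ B)) :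
    μ.real (A ∩ B) = μ.real A * μ.real B * Real.exp (logDep μ A B) := by
  rw [logDep, Real.exp_sub, Real.exp_sub, Real.exp_log hA0, Real.exp_log hB0, Real.exp_log hAB0]
  field_simp

end LogDep

/-- Here `q n = p ^ (1 / (n + 1))`, and `(p ^ h - 1) / h` tends to `log p` as `h` decreases to `0`.
-/
theorem tendsto_mul_one_sub_of_pow_eq {p : ℝ} (hp : 0 < p) {q : ℕ → ℝ} (hq : ∀ n, 0 ≤ q n)
    (h : ∀ n, p = q n ^ (n + 1)) :
    Tendsto (fun n : ℕ => ((n : ℝ) + 1) * (1 - q n)) atTop (𝓝 (-Real.log p)) := by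
  have hlim : Tendsto (fun n : ℕ => ((n : ℝ) + 1)⁻¹) atTop (𝓝[>] 0) := by
    refine tendsto_nhdsWithin_iff.2 ⟨?_, Eventually.of_forall fun n => ?_⟩
    · simpa [one_div] using tendsto_one_div_add_atTop_nhds_zero_nat (𝕜 := ℝ)
    · exact Set.mem_Ioi.2 (by positivity)
  refine ((tendsto_rpow_sub_one_log hp).comp hlim).neg.congr fun n => ?_
  have : p ^ ((n : ℝ) + 1)⁻¹ = q n := by
    have := Real.pow_rpow_inv_natCast (hq n) (Nat.succ_ne_zero n)
    rw [h n]
    exact_mod_cast this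
  simp only [Function.comp, this, inv_inv]
  ring

/-! ### Ideals and roots of max-infinitely divisible laws -/

section SupIdeal

variable {E : Type*} [SemilatticeSup E]

/-- A (possibly empty) order ideal: a supremum lies in `A` if and only if both terms do. -/
def IsSupIdeal (A : Set E) : Prop :=
  ∀ x y, x ⊔ y ∈ A ↔ x ∈ A ∧ y ∈ A

theorem IsSupIdeal.inter {A B : Set E} (hA : IsSupIdeal A) (hB : IsSupIdeal B) :
    IsSupIdeal (A ∩ B) := fun x y => by
  simp only [Set.mem_inter_iff, hA x y, hB x y]
  tauto

theorem IsSupIdeal.sup'_mem_iff {A : Set E} (hA : IsSupIdeal A) {ι : Type*} {s : Finset ι}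
    (hs : s.Nonempty) (f : ι → E) : s.sup' hs f ∈ A ↔ ∀ i ∈ s, f i ∈ A := by
  induction hs using Finset.Nonempty.cons_induction with
  | singleton a => simp
  | cons a s ha hs ih => simp [Finset.sup'_cons hs, hA _ _, ih]

variable [MeasurableSpace E]

/-- For every `n ≥ 1` there is a probability measure whose values on measurable order ideals are the
`n`-th roots of those of `μ`. -/
def HasIdealRoots (μ : Measure E) : Prop :=
  ∀ n : ℕ, ∃ ν : Measure E, IsProbabilityMeasure ν ∧
    ∀ A, MeasurableSet A → IsSupIdeal A → μ.real A = ν.real A ^ (n + 1)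

/-- The logarithmic dependence of two order ideals is the exponent measure of the intersection of
their complements. -/
theorem HasIdealRoots.exists_tendsto_logDep {μ : Measure E} (h : HasIdealRoots μ) :
    ∃ ν : ℕ → Measure E, (∀ n, IsProbabilityMeasure (ν n)) ∧
      ∀ A B, MeasurableSet A → MeasurableSet B → IsSupIdeal A → IsSupIdeal B →
        0 < μ.real A → 0 < μ.real B → 0 < μ.real (A ∩ B) ∧
          Tendsto (fun n : ℕ => ((n : ℝ) + 1) * (ν n).real (Aᶜ ∩ Bᶜ)) atTop
            (𝓝 (logDep μ A B)) := by
  choose ν hν hroot using h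
  refine ⟨ν, hν, fun A B hA hB hAi hBi hA0 hB0 => ?_⟩
  have key {C : Set E} (hC : MeasurableSet C) (hCi : IsSupIdeal C) (hC0 : 0 < μ.real C) :
      Tendsto (fun n : ℕ => ((n : ℝ) + 1) * (1 - (ν n).real C)) atTop
        (𝓝 (-Real.log (μ.real C))) :=
    tendsto_mul_one_sub_of_pow_eq hC0 (fun _ => measureReal_nonneg) fun n => hroot n C hC hCi
  have hincl (n : ℕ) : (ν n).real (Aᶜ ∩ Bᶜ) =
      (1 - (ν n).real A) + (1 - (ν n).real B) - (1 - (ν n).real (A ∩ B)) := by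
    have h1 := measureReal_union_add_inter (μ := ν n) (s := A) hB
    rw [← Set.compl_union, probReal_compl_eq_one_sub (hA.union hB)]
    linarith
  have hsmall {C : Set E} (hC : MeasurableSet C) (hCi : IsSupIdeal C) (hC0 : 0 < μ.real C) :
      ∀ᶠ n in atTop, 1 - (ν n).real C < 1 / 2 := by
    have := (tendsto_one_div_add_atTop_nhds_zero_nat (𝕜 := ℝ)).mul (key hC hCi hC0)
    rw [zero_mul] at this
    filter_upwards [this.eventually (gt_mem_nhds (show (0 : ℝ) < 1 / 2 by norm_num))] with n hn
    rwa [← mul_assoc, one_div_mul_cancel (by positivity), one_mul] at hn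
  -- For large `n` both roots exceed `1 / 2`, so the two sets must overlap in positive mass.
  have hAB0 : 0 < μ.real (A ∩ B) := by
    obtain ⟨n, hn1, hn2⟩ := ((hsmall hA hAi hA0).and (hsmall hB hBi hB0)).exists
    rw [hroot n _ (hA.inter hB) (hAi.inter hBi)]
    have h1 := hincl n
    have h2 : 0 ≤ (ν n).real (Aᶜ ∩ Bᶜ) := measureReal_nonneg
    have h3 : (ν n).real (A ∪ B) ≤ 1 := measureReal_le_one
    have h4 := measureReal_union_add_inter (μ := ν n) (s := A) hB
    have : 0 < (ν n).real (A ∩ B) := by linarith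
    positivity
  refine ⟨hAB0, ?_⟩
  have := ((key hA hAi hA0).add (key hB hBi hB0)).sub (key (hA.inter hB) (hAi.inter hBi) hAB0)
  rw [logDep]
  convert this using 1
  · ext n
    rw [hincl]
    ring
  · congr 1
    ring

variable {μ : Measure E}

theorem HasIdealRoots.measureReal_inter_pos (h : HasIdealRoots μ) {A B : Set E}
    (hA : MeasurableSet A) (hB : MeasurableSet B) (hAi : IsSupIdeal A) (hBi : IsSupIdeal B)
    (hA0 : 0 < μ.real A) (hB0 : 0 < μ.real B) : 0 < μ.real (A ∩ B) :=
  have ⟨_, _, H⟩ := h.exists_tendsto_logDep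
  (H A B hA hB hAi hBi hA0 hB0).1

/-- Order ideals are positively associated under a max-infinitely divisible law. -/
theorem HasIdealRoots.logDep_nonneg (h : HasIdealRoots μ) {A B : Set E}
    (hA : MeasurableSet A) (hB : MeasurableSet B) (hAi : IsSupIdeal A) (hBi : IsSupIdeal B)
    (hA0 : 0 < μ.real A) (hB0 : 0 < μ.real B) : 0 ≤ logDep μ A B :=
  have ⟨_, _, H⟩ := h.exists_tendsto_logDep
  ge_of_tendsto' (H A B hA hB hAi hBi hA0 hB0).2 fun _ => by positivity

/-- The union bound for each `ν n`, carried to the limit. -/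
theorem HasIdealRoots.logDep_le_sum (h : HasIdealRoots μ) {A B : Set E}
    (hA : MeasurableSet A) (hB : MeasurableSet B) (hAi : IsSupIdeal A) (hBi : IsSupIdeal B)
    (hA0 : 0 < μ.real A) (hB0 : 0 < μ.real B) {ι : Type*} (s : Finset ι) {C D : ι → Set E}
    (hC : ∀ i, MeasurableSet (C i)) (hD : ∀ i, MeasurableSet (D i)) (hCi : ∀ i, IsSupIdeal (C i))
    (hDi : ∀ i, IsSupIdeal (D i)) (hC0 : ∀ i, 0 < μ.real (C i)) (hD0 : ∀ i, 0 < μ.real (D i))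
    (hsub : Aᶜ ∩ Bᶜ ⊆ ⋃ i ∈ s, (C i)ᶜ ∩ (D i)ᶜ) :
    logDep μ A B ≤ ∑ i ∈ s, logDep μ (C i) (D i) := by
  obtain ⟨ν, hν, H⟩ := h.exists_tendsto_logDep
  refine le_of_tendsto_of_tendsto' (H A B hA hB hAi hBi hA0 hB0).2
    (tendsto_finsetSum s fun i _ =>
      (H (C i) (D i) (hC i) (hD i) (hCi i) (hDi i) (hC0 i) (hD0 i)).2) fun n => ?_
  rw [← Finset.mul_sum]
  gcongr
  exact (measureReal_mono hsub (measure_ne_top _ _)).trans (measureReal_biUnion_finset_le _ _)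

/-- With `ρ` the dependence, the difference is `μ (A ∩ B) * (1 - exp (-ρ))`, and `1 - exp (-ρ) ≤ ρ`.
-/
theorem HasIdealRoots.abs_measureReal_inter_sub_le [IsProbabilityMeasure μ] (h : HasIdealRoots μ)
    {A B : Set E} (hA : MeasurableSet A) (hB : MeasurableSet B) (hAi : IsSupIdeal A)
    (hBi : IsSupIdeal B) (hA0 : 0 < μ.real A) (hB0 : 0 < μ.real B) :
    |μ.real (A ∩ B) - μ.real A * μ.real B| ≤ logDep μ A B := by
  have hAB0 := h.measureReal_inter_pos hA hB hAi hBi hA0 hB0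
  have hρ := h.logDep_nonneg hA hB hAi hBi hA0 hB0
  have h1 : μ.real A * μ.real B = μ.real (A ∩ B) * Real.exp (-logDep μ A B) := by
    rw [exp_logDep hA0 hB0 hAB0, mul_assoc, ← Real.exp_add]
    simp
  have h2 : 1 - logDep μ A B ≤ Real.exp (-logDep μ A B) := by
    linarith [Real.add_one_le_exp (-logDep μ A B)]
  have h3 : Real.exp (-logDep μ A B) ≤ 1 := Real.exp_le_one_iff.2 (by linarith)
  have h4 : μ.real (A ∩ B) ≤ 1 := measureReal_le_one
  rw [h1, abs_of_nonneg (by nlinarith)]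
  nlinarith

/-- The right side is `exp ρ - 1` for the dependence `ρ`. -/
theorem HasIdealRoots.logDep_le_mul [IsProbabilityMeasure μ] (h : HasIdealRoots μ)
    {A B : Set E} (hA : MeasurableSet A) (hB : MeasurableSet B) (hAi : IsSupIdeal A)
    (hBi : IsSupIdeal B) (hA0 : 0 < μ.real A) (hB0 : 0 < μ.real B) :
    logDep μ A B ≤ (μ.real A * μ.real B)⁻¹ * (μ.real (A ∩ B) - μ.real A * μ.real B) := by
  have hAB0 := h.measureReal_inter_pos hA hB hAi hBi hA0 hB0
  have : (μ.real A * μ.real B)⁻¹ * (μ.real (A ∩ B) - μ.real A * μ.real B)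
      = Real.exp (logDep μ A B) - 1 := by
    rw [exp_logDep hA0 hB0 hAB0]
    field_simp
  rw [this]
  linarith [Real.add_one_le_exp (logDep μ A B)]

/-- The bound does not involve `B`, so it makes `tau` bounded uniformly in time. -/
theorem HasIdealRoots.logDep_le_neg_log [IsProbabilityMeasure μ] (h : HasIdealRoots μ)
    {A B : Set E} (hA : MeasurableSet A) (hB : MeasurableSet B) (hAi : IsSupIdeal A)
    (hBi : IsSupIdeal B) (hA0 : 0 < μ.real A) (hB0 : 0 < μ.real B) :
    logDep μ A B ≤ -Real.log (μ.real A) := by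
  have hAB0 := h.measureReal_inter_pos hA hB hAi hBi hA0 hB0
  have := Real.log_le_log hAB0 (measureReal_mono (μ := μ) (Set.inter_subset_right (s := A)))
  rw [logDep]
  linarith

end SupIdeal

/-! ### Cesàro means of translated sequences -/

section ShiftedMeans

theorem tendsto_cesaroMean_sub_of_abs_le {v : ℤ → ℝ} {M : ℝ} (hv : ∀ t, |v t| ≤ M) :
    Tendsto (cesaroMean fun t => v (t + 1) - v t) atTop (𝓝 0) := by
  have hsum (n : ℕ) : ∑ t ∈ Finset.range n, (v ((t + 1 : ℕ) + 1) - v (t + 1 : ℕ))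
      = v (n + 1) - v 1 := by
    have := Finset.sum_range_sub (fun t : ℕ => v (t + 1)) n
    push_cast at this ⊢
    simpa using this
  have hlim : Tendsto (fun n : ℕ => (n : ℝ)⁻¹ * (2 * M)) atTop (𝓝 0) := by
    simpa using (tendsto_inv_atTop_nhds_zero_nat (𝕜 := ℝ)).mul_const (2 * M)
  refine squeeze_zero_norm (fun n => ?_) hlim
  rw [cesaroMean_eq_sum_range, hsum, norm_mul, Real.norm_of_nonneg (by positivity)]
  gcongr
  have h1 := hv (n + 1)
  have h2 := hv 1
  rw [Real.norm_eq_abs]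
  exact (abs_sub _ _).trans (by linarith)

/-- A unit translation changes the mean of a bounded sequence by a telescoping term of order `1 /
n`; induction in both directions gives every integer `k`. -/
theorem tendsto_cesaroMean_comp_add {u : ℤ → ℝ} {M : ℝ} (hu : ∀ t, |u t| ≤ M)
    (h : Tendsto (cesaroMean fun t => u t) atTop (𝓝 0)) (k : ℤ) :
    Tendsto (cesaroMean fun t => u (t + k)) atTop (𝓝 0) := by
  have hdiff (k : ℤ) : Tendsto (cesaroMean fun t => u (t + 1 + k) - u (t + k)) atTop (𝓝 0) :=
    tendsto_cesaroMean_sub_of_abs_le (v := fun t => u (t + k)) fun t => hu _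
  induction k using Int.induction_on with
  | zero => simpa using h
  | succ i ih =>
    have := (hdiff i).add ih
    rw [add_zero] at this
    refine this.congr fun n => ?_
    rw [cesaroMean_sub, sub_add_cancel]
    simp only [add_assoc, add_comm (1 : ℤ)]
  | pred i ih =>
    have := ih.sub (hdiff (-i - 1))
    rw [sub_zero] at this
    refine this.congr fun n => ?_
    have hi (t : ℕ) : (t : ℤ) + 1 + (-i - 1) = t + -i := by ring
    simp only [hi]
    rw [cesaroMean_sub, sub_sub_cancel]

end ShiftedMeans

/-! ### Half-spaces and orthants of paths -/

section Orthants

/-- The paths that do not exceed `c` at time `t`. -/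
def belowAt (t : ℤ) (c : ℝ) : Set (ℤ → ℝ) := {x | x t ≤ c}

theorem measurableSet_belowAt (t : ℤ) (c : ℝ) : MeasurableSet (belowAt t c) :=
  measurable_pi_apply t measurableSet_Iic

theorem isSupIdeal_belowAt (t : ℤ) (c : ℝ) : IsSupIdeal (belowAt t c) :=
  fun _ _ => by simp [belowAt]

/-- The paths below finitely many prescribed levels at prescribed times. -/
def orthant (K : Finset (ℤ × ℝ)) : Set (ℤ → ℝ) := {x | ∀ p ∈ K, x p.1 < p.2}

theorem measurableSet_orthant (K : Finset (ℤ × ℝ)) : MeasurableSet (orthant K) := by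
  have : orthant K = ⋂ p ∈ K, (fun x : ℤ → ℝ => x p.1) ⁻¹' Set.Iio p.2 := by
    ext x
    simp [orthant]
  rw [this]
  exact Finset.measurableSet_biInter _ fun p _ => measurable_pi_apply p.1 measurableSet_Iio

theorem isSupIdeal_orthant (K : Finset (ℤ × ℝ)) : IsSupIdeal (orthant K) := fun x y => by
  simp only [orthant, Set.mem_ofPred_eq, Pi.sup_apply, sup_lt_iff]
  exact ⟨fun h => ⟨fun p hp => (h p hp).1, fun p hp => (h p hp).2⟩,
    fun h p hp => ⟨h.1 p hp, h.2 p hp⟩⟩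

theorem isPiSystem_orthant : IsPiSystem (Set.range orthant) := by
  classical
  rintro _ ⟨K, rfl⟩ _ ⟨K', rfl⟩ _
  refine ⟨K ∪ K', ?_⟩
  ext x
  simp only [orthant, Finset.mem_union, Set.mem_ofPred_eq, Set.mem_inter_iff]
  exact ⟨fun h => ⟨fun p hp => h p (.inl hp), fun p hp => h p (.inr hp)⟩,
    fun h p hp => hp.elim (h.1 p) (h.2 p)⟩

theorem generateFrom_orthant :
    MeasurableSpace.pi = MeasurableSpace.generateFrom (Set.range orthant) := by
  refine le_antisymm (iSup_le fun t => ?_) (MeasurableSpace.generateFrom_le ?_)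
  · rw [← measurable_iff_comap_le]
    let _ : MeasurableSpace (ℤ → ℝ) := MeasurableSpace.generateFrom (Set.range orthant)
    refine measurable_of_Iio fun a => ?_
    refine MeasurableSpace.measurableSet_generateFrom ⟨{(t, a)}, ?_⟩
    ext x
    simp [orthant]
  · rintro _ ⟨K, rfl⟩
    exact measurableSet_orthant K

end Orthants

/-! ### The law of the process and the three implications -/

section PathLaw

variable {Ω : Type*} [MeasurableSpace Ω] {P : Measure Ω} {X : ℤ → Ω → ℝ}

theorem isProbabilityMeasure_pathLaw [IsProbabilityMeasure P] (hX : ∀ t, Measurable (X t)) :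
    IsProbabilityMeasure (pathLaw X P) :=
  Measure.isProbabilityMeasure_map (measurable_pi_lambda _ hX).aemeasurable

theorem pathLaw_real (hX : ∀ t, Measurable (X t)) {A : Set (ℤ → ℝ)} (hA : MeasurableSet A) :
    (pathLaw X P).real A = P.real {ω | (fun t => X t ω) ∈ A} :=
  map_measureReal_apply (measurable_pi_lambda _ hX) hA

theorem measurable_translate (s : ℤ) : Measurable fun (x : ℤ → ℝ) (t : ℤ) => x (t + s) :=
  measurable_pi_lambda _ fun _ => measurable_pi_apply _

theorem IsStationary.measurePreserving_translate (h : IsStationary X P)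
    (hX : ∀ t, Measurable (X t)) (s : ℤ) :
    MeasurePreserving (fun (x : ℤ → ℝ) (t : ℤ) => x (t + s)) (pathLaw X P) (pathLaw X P) := by
  refine ⟨measurable_translate s, ?_⟩
  conv_rhs => rw [← h s]
  exact Measure.map_map (measurable_translate s) (measurable_pi_lambda _ hX)

theorem IsStationary.measurePreserving_shift (h : IsStationary X P) (hX : ∀ t, Measurable (X t)) :
    MeasurePreserving shift (pathLaw X P) (pathLaw X P) :=
  h.measurePreserving_translate hX 1

theorem shift_iterate_apply (n : ℕ) (x : ℤ → ℝ) (t : ℤ) : shift^[n] x t = x (t + n) := by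
  induction n generalizing x with
  | zero => simp
  | succ n ih =>
    rw [Function.iterate_succ_apply, ih, shift]
    congr 1
    push_cast
    ring

theorem preimage_shift_iterate_belowAt (n : ℕ) (c : ℝ) :
    shift^[n] ⁻¹' belowAt 0 c = belowAt n c := by
  ext x
  simp [belowAt, shift_iterate_apply]

theorem isSupIdeal_preimage_shift_iterate {A : Set (ℤ → ℝ)} (hA : IsSupIdeal A) (n : ℕ) :
    IsSupIdeal (shift^[n] ⁻¹' A) := fun x y => by
  have : shift^[n] (x ⊔ y) = shift^[n] x ⊔ shift^[n] y := by
    ext t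
    simp [shift_iterate_apply]
  rw [Set.mem_preimage, this, hA]
  rfl

/-- A maximum of `n + 1` paths lies in an ideal exactly when each path does, so independence turns
its probability into a power. -/
theorem IsMaxID.hasIdealRoots (h : IsMaxID X P) : HasIdealRoots (pathLaw X P) := by
  intro n
  obtain ⟨ν, hν, hlaw⟩ := h (n + 1) n.succ_pos
  refine ⟨ν, hν, fun A hA hAi => ?_⟩
  have hmeas : Measurable fun (y : Fin (n + 1) → ℤ → ℝ) (t : ℤ) => ⨆ i, y i t :=
    measurable_pi_lambda _ fun t => Measurable.iSup fun i =>
      (measurable_pi_apply t).comp (measurable_pi_apply i)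
  have hsup (y : Fin (n + 1) → ℤ → ℝ) :
      (fun t => ⨆ i, y i t) = Finset.univ.sup' Finset.univ_nonempty y := by
    ext t
    rw [Finset.sup'_apply, Finset.sup'_univ_eq_ciSup]
  have hpre : (fun (y : Fin (n + 1) → ℤ → ℝ) (t : ℤ) => ⨆ i, y i t) ⁻¹' A
      = Set.univ.pi fun _ => A := by
    ext y
    rw [Set.mem_preimage, hsup, hAi.sup'_mem_iff]
    simp
  rw [hlaw, map_measureReal_apply hmeas hA, hpre, measureReal_def, Measure.pi_pi]
  simp [measureReal_def]

theorem tau_eq_logDep (hX : ∀ t, Measurable (X t)) (a : ℝ) (t : ℤ) :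
    tau X P a t = logDep (pathLaw X P) (belowAt 0 a) (belowAt t a) := by
  rw [logDep, pathLaw_real hX ((measurableSet_belowAt 0 a).inter (measurableSet_belowAt t a)),
    pathLaw_real hX (measurableSet_belowAt 0 a), pathLaw_real hX (measurableSet_belowAt t a)]
  rfl

theorem IsStationary.measureReal_preimage_translate (h : IsStationary X P)
    (hX : ∀ t, Measurable (X t)) (s : ℤ) {A : Set (ℤ → ℝ)} (hA : MeasurableSet A) :
    (pathLaw X P).real {x | (fun t => x (t + s)) ∈ A} = (pathLaw X P).real A :=
  (h.measurePreserving_translate hX s).measureReal_preimage hA.nullMeasurableSet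

theorem IsStationary.measureReal_belowAt (h : IsStationary X P) (hX : ∀ t, Measurable (X t))
    (t : ℤ) (c : ℝ) :
    (pathLaw X P).real (belowAt t c) = (pathLaw X P).real (belowAt 0 c) := by
  rw [← h.measureReal_preimage_translate hX t (measurableSet_belowAt 0 c)]
  simp [belowAt]

theorem IsStationary.logDep_belowAt (h : IsStationary X P) (hX : ∀ t, Measurable (X t))
    (s t : ℤ) (c : ℝ) :
    logDep (pathLaw X P) (belowAt s c) (belowAt t c) = tau X P c (t - s) := by
  rw [tau_eq_logDep hX, logDep, logDep, h.measureReal_belowAt hX s, h.measureReal_belowAt hX t,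
    h.measureReal_belowAt hX (t - s), ← h.measureReal_preimage_translate hX s
      ((measurableSet_belowAt 0 c).inter (measurableSet_belowAt (t - s) c))]
  simp [belowAt, Set.ofPred_and]

variable [IsProbabilityMeasure P]

theorem lowerEndpoint_lt_iff (a : ℝ) :
    lowerEndpoint X P < a ↔ 0 < P.real {ω | X 0 ω < a} := by
  rw [measureReal_nonneg.lt_iff_ne', ne_eq, measureReal_eq_zero_iff, ← not_le, not_iff_not]
  have : P {ω | X 0 ω < a} = 0 ↔ ∀ᵐ ω ∂P, (a : EReal) ≤ X 0 ω := by
    simp [ae_iff]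
  rw [this]
  exact ⟨fun h => (ae_essInf_le (μ := P)).mono fun _ hω => h.trans hω, fun h => le_essInf_of_ae_le _ h⟩

theorem lowerEndpoint_lt_top : lowerEndpoint X P < ⊤ := by
  refine lt_top_iff_ne_top.2 fun h => ?_
  obtain ⟨ω, hω⟩ := (ae_essInf_le (μ := P) (f := fun ω => (X 0 ω : EReal))).exists
  rw [← lowerEndpoint, h, top_le_iff] at hω
  exact EReal.coe_ne_top _ hω

/-- Finitely many levels above the lower endpoint are separated from it by a real number. -/
theorem exists_lowerEndpoint_lt_forall_lt (K : Finset (ℤ × ℝ))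
    (hK : ∀ p ∈ K, lowerEndpoint X P < p.2) :
    ∃ c : ℝ, lowerEndpoint X P < c ∧ ∀ p ∈ K, c < p.2 := by
  induction K using Finset.cons_induction with
  | empty =>
    obtain ⟨c, hc, -⟩ := EReal.lt_iff_exists_real_btwn.1 (lowerEndpoint_lt_top (X := X) (P := P))
    exact ⟨c, hc, by simp⟩
  | cons p K hp ih =>
    obtain ⟨c, hc, hcK⟩ := ih fun q hq => hK q (Finset.mem_cons_of_mem hq)
    obtain ⟨c', hc', hlt⟩ := EReal.lt_iff_exists_real_btwn.1
      (lt_min hc (hK p (Finset.mem_cons_self p K)))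
    obtain ⟨h1, h2⟩ := lt_min_iff.1 hlt
    refine ⟨c', hc', fun q hq => ?_⟩
    rcases Finset.mem_cons.1 hq with rfl | hq
    · exact EReal.coe_lt_coe_iff.1 h2
    · exact (EReal.coe_lt_coe_iff.1 h1).trans (hcK q hq)

theorem IsStationary.measureReal_belowAt_pos (h : IsStationary X P) (hX : ∀ t, Measurable (X t))
    (t : ℤ) {c : ℝ} (hc : lowerEndpoint X P < c) : 0 < (pathLaw X P).real (belowAt t c) := by
  rw [h.measureReal_belowAt hX, pathLaw_real hX (measurableSet_belowAt 0 c)]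
  refine ((lowerEndpoint_lt_iff c).1 hc).trans_le (measureReal_mono fun ω hω => ?_)
  simp only [Set.mem_ofPred_eq, belowAt] at hω ⊢
  exact hω.le

/-- This needs the strict inequalities in `orthant`: with `≤`, an atom at the lower endpoint would
allow a level equal to it. -/
theorem IsStationary.lowerEndpoint_lt_of_orthant_pos (h : IsStationary X P)
    (hX : ∀ t, Measurable (X t)) {K : Finset (ℤ × ℝ)} (hK : 0 < (pathLaw X P).real (orthant K))
    {p : ℤ × ℝ} (hp : p ∈ K) : lowerEndpoint X P < p.2 := by
  have := isProbabilityMeasure_pathLaw (P := P) hX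
  have hmeas : MeasurableSet {x : ℤ → ℝ | x 0 < p.2} := measurable_pi_apply 0 measurableSet_Iio
  rw [lowerEndpoint_lt_iff]
  refine hK.trans_le ((measureReal_mono fun x hx => ?_).trans_eq
    ((h.measureReal_preimage_translate hX p.1 hmeas).trans (pathLaw_real hX hmeas)))
  simpa using hx p hp

theorem tendsto_cesaroMean_orthant (hX : ∀ t, Measurable (X t)) (hstat : IsStationary X P)
    (hmax : IsMaxID X P)
    (hτ : ∀ a : ℝ, lowerEndpoint X P < a → Tendsto (cesaroMean fun t => tau X P a t) atTop (𝓝 0))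
    (K K' : Finset (ℤ × ℝ)) :
    Tendsto (cesaroMean fun t =>
      |(pathLaw X P).real (orthant K ∩ shift^[t] ⁻¹' orthant K') -
        (pathLaw X P).real (orthant K) * (pathLaw X P).real (orthant K')|) atTop (𝓝 0) := by
  classical
  have hprob := isProbabilityMeasure_pathLaw (P := P) hX
  have hshift (t : ℕ) := (hstat.measurePreserving_shift hX).iterate t
  have hpre (t : ℕ) : (pathLaw X P).real (shift^[t] ⁻¹' orthant K')
      = (pathLaw X P).real (orthant K') :=
    (hshift t).measureReal_preimage (measurableSet_orthant K').nullMeasurableSet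
  -- Null orthants are treated apart, since `logDep` is controlled only for events of positive mass.
  rcases measureReal_nonneg.eq_or_lt' (a := (pathLaw X P).real (orthant K)) with h0 | h0
  · refine tendsto_cesaroMean_zero_of_le (fun _ => abs_nonneg _) (v := fun _ => 0) (fun t => ?_)
      (tendsto_cesaroMean_const 0)
    have := measureReal_mono (μ := pathLaw X P)
      (Set.inter_subset_left (s := orthant K) (t := shift^[t] ⁻¹' orthant K'))
    rw [h0] at this ⊢
    simp [le_antisymm this measureReal_nonneg]
  rcases measureReal_nonneg.eq_or_lt' (a := (pathLaw X P).real (orthant K')) with h0' | h0'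
  · refine tendsto_cesaroMean_zero_of_le (fun _ => abs_nonneg _) (v := fun _ => 0) (fun t => ?_)
      (tendsto_cesaroMean_const 0)
    have := measureReal_mono (μ := pathLaw X P)
      (Set.inter_subset_right (s := orthant K) (t := shift^[t] ⁻¹' orthant K'))
    rw [hpre, h0'] at this
    rw [h0']
    simp [le_antisymm this measureReal_nonneg]
  -- Leaving an orthant forces the path above `c` at one of its times, so a single level `c` serves
  -- every pair of coordinates.
  obtain ⟨c, hc, hcK⟩ := exists_lowerEndpoint_lt_forall_lt (X := X) (P := P) (K ∪ K')
    fun p hp => (Finset.mem_union.1 hp).elim (hstat.lowerEndpoint_lt_of_orthant_pos hX h0)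
      (hstat.lowerEndpoint_lt_of_orthant_pos hX h0')
  have hroots := hmax.hasIdealRoots
  have hpos (t : ℤ) := hstat.measureReal_belowAt_pos hX t hc
  have hbound (t : ℤ) : |tau X P c t| ≤ -Real.log ((pathLaw X P).real (belowAt 0 c)) := by
    rw [tau_eq_logDep hX, abs_of_nonneg (hroots.logDep_nonneg (measurableSet_belowAt _ _)
      (measurableSet_belowAt _ _) (isSupIdeal_belowAt _ _) (isSupIdeal_belowAt _ _) (hpos _)
      (hpos _))]
    exact hroots.logDep_le_neg_log (measurableSet_belowAt _ _)
      (measurableSet_belowAt _ _) (isSupIdeal_belowAt _ _) (isSupIdeal_belowAt _ _) (hpos _)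
      (hpos _)
  have hlim : Tendsto (cesaroMean fun t => ∑ i ∈ K ×ˢ K', tau X P c (t + (i.2.1 - i.1.1))) atTop
      (𝓝 0) := by
    have := tendsto_finsetSum (K ×ˢ K') fun i _ =>
      tendsto_cesaroMean_comp_add hbound (hτ c hc) (i.2.1 - i.1.1)
    rw [Finset.sum_const_zero] at this
    exact this.congr fun n => (cesaroMean_finset_sum _ _ n).symm
  refine tendsto_cesaroMean_zero_of_le (fun _ => abs_nonneg _) (fun t => ?_) hlim
  have hB : MeasurableSet (shift^[t] ⁻¹' orthant K') :=
    (hshift t).measurable (measurableSet_orthant K')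
  have hBi := isSupIdeal_preimage_shift_iterate (isSupIdeal_orthant K') t
  have hB0 : 0 < (pathLaw X P).real (shift^[t] ⁻¹' orthant K') := by rwa [hpre]
  rw [← hpre t]
  refine (hroots.abs_measureReal_inter_sub_le (measurableSet_orthant K) hB (isSupIdeal_orthant K)
    hBi h0 hB0).trans ?_
  refine (hroots.logDep_le_sum (measurableSet_orthant K) hB (isSupIdeal_orthant K) hBi h0 hB0
    (K ×ˢ K') (C := fun i => belowAt i.1.1 c) (D := fun i => belowAt (i.2.1 + t) c)
    (fun _ => measurableSet_belowAt _ _) (fun _ => measurableSet_belowAt _ _)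
    (fun _ => isSupIdeal_belowAt _ _) (fun _ => isSupIdeal_belowAt _ _) (fun _ => hpos _)
    (fun _ => hpos _) ?_).trans_eq ?_
  · rintro x ⟨hx, hx'⟩
    simp only [orthant, Set.mem_compl_iff, Set.mem_ofPred_eq, Set.mem_preimage, not_forall, not_lt,
      shift_iterate_apply] at hx hx'
    obtain ⟨p, hp, hxp⟩ := hx
    obtain ⟨q, hq, hxq⟩ := hx'
    simp only [Set.mem_iUnion]
    refine ⟨(p, q), Finset.mk_mem_product hp hq, ?_, ?_⟩
    · exact not_le.2 ((hcK p (Finset.mem_union_left _ hp)).trans_le hxp)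
    · exact not_le.2 ((hcK q (Finset.mem_union_right _ hq)).trans_le hxq)
  · refine Finset.sum_congr rfl fun i _ => ?_
    rw [hstat.logDep_belowAt hX]
    congr 1
    ring

theorem isWeaklyMixing_of_tendsto_tau (hX : ∀ t, Measurable (X t)) (hstat : IsStationary X P)
    (hmax : IsMaxID X P)
    (hτ : ∀ a : ℝ, lowerEndpoint X P < a → Tendsto (cesaroMean fun t => tau X P a t) atTop (𝓝 0)) :
    IsWeaklyMixing X P := by
  have hprob := isProbabilityMeasure_pathLaw (P := P) hX
  have hshift := hstat.measurePreserving_shift hX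
  refine ⟨hshift, fun A B hA hB => ?_⟩
  refine tendsto_cesaroMean_abs_measureReal_inter_of_isPiSystem hshift generateFrom_orthant
    isPiSystem_orthant ?_ hA hB
  rintro _ ⟨K, rfl⟩ _ ⟨K', rfl⟩
  exact tendsto_cesaroMean_orthant hX hstat hmax hτ K K'

theorem IsWeaklyMixing.isErgodic (hX : ∀ t, Measurable (X t)) (h : IsWeaklyMixing X P) :
    IsErgodic X P := by
  have hprob := isProbabilityMeasure_pathLaw (P := P) hX
  refine ⟨h.1, ⟨fun A hA hinv => ?_⟩⟩
  have hiter (t : ℕ) : shift^[t] ⁻¹' A = A := by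
    rw [Set.preimage_iterate_eq]
    exact Function.iterate_fixed hinv t
  have hlim := h.2 A A hA hA
  simp only [hiter, Set.inter_self] at hlim
  -- For invariant `A` the averaged sequence is constant, so its value is zero.
  have h0 := tendsto_nhds_unique hlim (tendsto_cesaroMean_const _)
  rw [eq_comm, abs_eq_zero, ← mul_one_sub, mul_eq_zero, sub_eq_zero] at h0
  rw [eventuallyConst_set']
  rcases h0 with h0 | h0
  · exact .inl (ae_eq_empty.2 ((measureReal_eq_zero_iff).1 h0))
  · refine .inr (ae_eq_univ.2 ((prob_compl_eq_zero_iff hA).2 ?_))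
    rw [← ofReal_measureReal, ← h0, ENNReal.ofReal_one]

theorem IsErgodic.tendsto_tau (h : IsErgodic X P) (hX : ∀ t, Measurable (X t))
    (hstat : IsStationary X P) (hmax : IsMaxID X P) {a : ℝ} (ha : lowerEndpoint X P < a) :
    Tendsto (cesaroMean fun t => tau X P a t) atTop (𝓝 0) := by
  have hprob := isProbabilityMeasure_pathLaw (P := P) hX
  have hroots := hmax.hasIdealRoots
  have hA := measurableSet_belowAt 0 a
  have hAi := isSupIdeal_belowAt 0 a
  have hpos (t : ℤ) := hstat.measureReal_belowAt_pos hX t ha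
  set p := (pathLaw X P).real (belowAt 0 a)
  have hlim : Tendsto (cesaroMean fun t =>
      (p * p)⁻¹ * ((pathLaw X P).real (belowAt 0 a ∩ shift^[t] ⁻¹' belowAt 0 a) - p * p)) atTop
      (𝓝 0) := by
    have := ((tendsto_cesaroMean_measureReal_inter h hA hA).sub
      (tendsto_cesaroMean_const (p * p))).const_mul (p * p)⁻¹
    rw [sub_self, mul_zero] at this
    refine this.congr fun n => ?_
    rw [cesaroMean_const_mul _ fun t => _ - p * p, cesaroMean_sub]
  refine tendsto_cesaroMean_zero_of_le (fun t => ?_) (fun t => ?_) hlim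
  · rw [tau_eq_logDep hX]
    exact hroots.logDep_nonneg hA (measurableSet_belowAt _ _) hAi (isSupIdeal_belowAt _ _) (hpos 0)
      (hpos t)
  · rw [tau_eq_logDep hX, preimage_shift_iterate_belowAt]
    have := hroots.logDep_le_mul hA (measurableSet_belowAt t a) hAi (isSupIdeal_belowAt _ _)
      (hpos 0) (hpos t)
    rwa [hstat.measureReal_belowAt hX t] at this

end PathLaw

end MaxID

end

theorem theorem2 {Ω : Type*} [MeasurableSpace Ω] (P : Measure Ω) [IsProbabilityMeasure P]
    (X : ℤ → Ω → ℝ) (hX : ∀ t, Measurable (X t))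
    (hstat : MaxID.IsStationary X P) (hmax : MaxID.IsMaxID X P) :
    List.TFAE [
      MaxID.IsErgodic X P,
      MaxID.IsWeaklyMixing X P,
      ∀ a : ℝ, MaxID.lowerEndpoint X P < (a : EReal) →
        Tendsto (fun n : ℕ => (1 / (n : ℝ)) * ∑ t ∈ Finset.Icc 1 n, MaxID.tau X P a (t : ℤ))
          atTop (𝓝 0)] := by
  tfae_have 1 → 3 := fun h _ ha => h.tendsto_tau hX hstat hmax ha
  tfae_have 3 → 2 := fun h => MaxID.isWeaklyMixing_of_tendsto_tau hX hstat hmax h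
  tfae_have 2 → 1 := fun h => h.isErgodic hX
  tfae_finish
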